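/- Let $n>1$ and let $\mathbb M^n=\mathbb R^n$ be $n$-dimensional Minkowski space with the form $\langle x,y\rangle=-x_0y_0+x_1y_1+\dots+x_{n-1}y_{n-1}$. Let $\mathcal L_0$ be the connected component of the identity in the full Lorentz group $O(n-1,1)$, acting linearly on $\mathbb M^n$, and let $\mathcal H=\{x\in\mathbb M^n:\langle x,x\rangle=-1,\ x_0>0\}$ be the hyperboloid of unit future-timelike vectors, with its Borel $\sigma$-algebra. Let $\Omega$ be the set of locally finite subsets of $\mathbb M^n$ ("sprinklings"), with the $\sigma$-algebra $\Sigma$ generated by the maps $\omega\mapsto|\omega\cap B|$, $B\subset\mathbb M^n$ bounded Borel, and with the action $\Lambda\omega=\{\Lambda x:x\in\omega\}$ of $\mathcal L_0$. Let $\mu$ be the law on $(\Omega,\Sigma)$ of the Poisson process of density $\rho>0$ with respect to Lebesgue measure, that is, the probability measure under which $|\omega\cap B|$ is Poisson distributed with mean $\rho\operatorname{vol}(B)$ for every bounded Borel set $B$, and under which the numbers of points in finitely many pairwise disjoint bounded Borel sets are independent. Let $S\in\Sigma$ with $\mu(S)>0$. Then there is no measurable map $D:S\to\mathcal H$ that is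 $\mathcal L_0$-equivariant, i.e. such that $$D(\Lambda\omega)=\Lambda D(\omega)\qquad\text{for all }\Lambda\in\mathcal L_0\text{ and all }\omega\in S\text{ with }\Lambda\omega\in S .$$ In particular this holds when $S$ is $\mathcal L_0$-invariant. -/

import Mathlib

open MeasureTheory ProbabilityTheory
open scoped NNReal ENNReal Matrix

noncomputable section

/-- Minkowski space of dimension `d + 1`, in inertial coordinates centred at the origin `O`:
coordinate `0` is time, the other `d` coordinates are space. -/
abbrev Minkowski (d : ℕ) : Type := Fin (d + 1) → ℝ

/-- The matrix `diag (-1, 1, …, 1)` of the Minkowski inner product. -/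
def minkowskiMatrix (d : ℕ) : Matrix (Fin (d + 1)) (Fin (d + 1)) ℝ :=
  Matrix.diagonal fun i => if i = 0 then -1 else 1

/-- The Minkowski inner product `-x₀ y₀ + x₁ y₁ + ⋯ + x_d y_d`. -/
def minkowskiInner {d : ℕ} (x y : Minkowski d) : ℝ :=
  x ⬝ᵥ (minkowskiMatrix d *ᵥ y)

/-- The full Lorentz group `O(d, 1)`, with the topology induced from `GL (d + 1, ℝ)`. -/
def fullLorentzGroup (d : ℕ) : Subgroup (GL (Fin (d + 1)) ℝ) where
  carrier := {A | ∀ x y : Minkowski d,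
    minkowskiInner ((A : Matrix (Fin (d + 1)) (Fin (d + 1)) ℝ) *ᵥ x)
      ((A : Matrix (Fin (d + 1)) (Fin (d + 1)) ℝ) *ᵥ y) = minkowskiInner x y}
  one_mem' := by intro x y; simp
  mul_mem' := by
    intro A B hA hB x y
    have h := hA ((B : Matrix (Fin (d + 1)) (Fin (d + 1)) ℝ) *ᵥ x)
      ((B : Matrix (Fin (d + 1)) (Fin (d + 1)) ℝ) *ᵥ y)
    rw [hB x y] at h
    simpa [Matrix.mulVec_mulVec] using h
  inv_mem' := by
    intro A hA x y
    have h := hA (((A⁻¹ : GL (Fin (d + 1)) ℝ) : Matrix (Fin (d + 1)) (Fin (d + 1)) ℝ) *ᵥ x)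
      (((A⁻¹ : GL (Fin (d + 1)) ℝ) : Matrix (Fin (d + 1)) (Fin (d + 1)) ℝ) *ᵥ y)
    rw [Matrix.mulVec_mulVec, Matrix.mulVec_mulVec, Units.mul_inv, Matrix.one_mulVec,
      Matrix.one_mulVec] at h
    exact h.symm

/-- The Lorentz group `L₀`: the connected component of the identity in `O(d, 1)`. -/
def lorentzGroup (d : ℕ) : Subgroup (GL (Fin (d + 1)) ℝ) :=
  (Subgroup.connectedComponentOfOne (fullLorentzGroup d)).map (fullLorentzGroup d).subtype

/-- The linear action of a Lorentz transformation on Minkowski space, fixing the origin. -/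
def lorentzAct {d : ℕ} (L : lorentzGroup d) (x : Minkowski d) : Minkowski d :=
  ((L : GL (Fin (d + 1)) ℝ) : Matrix (Fin (d + 1)) (Fin (d + 1)) ℝ) *ᵥ x

/-- The hyperboloid `H` of unit future-timelike vectors, a measurable space with the Borel
σ-algebra it inherits as a subspace of Minkowski space. -/
abbrev Hyperboloid (d : ℕ) : Type :=
  {x : Minkowski d // minkowskiInner x x = -1 ∧ 0 < x 0}

/-- A possible sprinkling, that is, a point of `Ω`: a locally finite subset of Minkowski space
(equivalently, a subset without accumulation points). -/
@[ext]
structure Sprinkling (d : ℕ) where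
  points : Set (Minkowski d)
  locallyFinite : ∀ K : Set (Minkowski d), IsCompact K → (points ∩ K).Finite

/-- The number of points of a sprinkling in a region. It is used for bounded regions only, where
it is always finite. -/
def Sprinkling.count {d : ℕ} (B : Set (Minkowski d)) (ω : Sprinkling d) : ℕ :=
  (ω.points ∩ B).ncard

/-- The σ-algebra `Σ` on `Ω`: the smallest one for which the number of points in each bounded
Borel set is a measurable function. -/
instance Sprinkling.instMeasurableSpace (d : ℕ) : MeasurableSpace (Sprinkling d) :=
  MeasurableSpace.generateFrom
    {E | ∃ B : Set (Minkowski d), MeasurableSet B ∧ Bornology.IsBounded B ∧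
      ∃ k : ℕ, E = {ω | ω.count B = k}}

/-- The action of the Lorentz group on sprinklings, pointwise. -/
def Sprinkling.act {d : ℕ} (L : lorentzGroup d) (ω : Sprinkling d) : Sprinkling d where
  points := lorentzAct L '' ω.points
  locallyFinite := by
    intro K hK
    have hK' : IsCompact (lorentzAct L⁻¹ '' K) := by
      refine hK.image ?_
      unfold lorentzAct
      fun_prop
    refine ((ω.locallyFinite _ hK').image (lorentzAct L)).subset ?_
    rintro _ ⟨⟨x, hx, rfl⟩, hxK⟩
    refine ⟨x, ⟨hx, lorentzAct L x, hxK, ?_⟩, rfl⟩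
    simp only [lorentzAct, Matrix.mulVec_mulVec, Subgroup.coe_inv]
    rw [Units.inv_mul, Matrix.one_mulVec]

/-- `μ` is the law on `Ω` of the Poisson process of density `ρ`: the number of points in a bounded
Borel set of volume `V` is Poisson distributed with mean `ρ V`, and the numbers of points in
finitely many pairwise disjoint bounded Borel sets are independent. -/
structure IsPoissonProcess {d : ℕ} (ρ : ℝ) (μ : Measure (Sprinkling d)) : Prop where
  isProbabilityMeasure : IsProbabilityMeasure μ
  poisson : ∀ B : Set (Minkowski d), MeasurableSet B → Bornology.IsBounded B → ∀ k : ℕ,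
    μ {ω | ω.count B = k} = ENNReal.ofReal
      ((ρ * (volume B).toReal) ^ k * Real.exp (-(ρ * (volume B).toReal)) / (k.factorial : ℝ))
  independent : ∀ (m : ℕ) (B : Fin m → Set (Minkowski d)), (∀ i, MeasurableSet (B i)) →
    (∀ i, Bornology.IsBounded (B i)) → Pairwise (fun i j => Disjoint (B i) (B j)) →
    iIndepFun (fun i => Sprinkling.count (B i)) μ

end

/-! ### Counting points of a sprinkling -/

namespace Sprinkling

variable {d : ℕ}

/-! An equivariant direction would contradict Poincaré recurrence under a single boost. The Poisson
law is determined by its counts (`IsPoissonProcess.eq`), and Lorentz maps preserve volume, so every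
Lorentz transformation preserves μ (`IsPoissonProcess.measurePreserving_act`).

On the hyperboloid the light-cone coordinate x₀ + x₁ is positive, and the boost of rapidity 1
multiplies it by e. By equivariance, u(ω) = D(ω)₀ + D(ω)₁ then grows like eⁿ along the boost orbit
of ω, at all times when the orbit lies in S. But u is bounded above and away from 0 on some set of
positive measure, and recurrence brings some point of that set back after arbitrarily many steps.
Neither ergodicity of the action nor invariance of S is needed. -/

theorem measurable_count {B : Set (Minkowski d)} (hB : MeasurableSet B)
    (hb : Bornology.IsBounded B) : Measurable (Sprinkling.count B) :=
  measurable_to_countable' fun k =>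
    MeasurableSpace.measurableSet_generateFrom ⟨B, hB, hb, k, rfl⟩

theorem finite_inter (ω : Sprinkling d) {B : Set (Minkowski d)} (hb : Bornology.IsBounded B) :
    (ω.points ∩ B).Finite :=
  (ω.locallyFinite _ hb.isCompact_closure).subset
    (Set.inter_subset_inter_right _ subset_closure)

theorem count_biUnion {κ : Type*} (ω : Sprinkling d) (t : Finset κ) {A : κ → Set (Minkowski d)}
    (hb : ∀ i, Bornology.IsBounded (A i)) (hA : Pairwise fun i j => Disjoint (A i) (A j)) :
    ω.count (⋃ i ∈ t, A i) = ∑ i ∈ t, ω.count (A i) := by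
  classical
  induction t using Finset.induction_on with
  | empty => simp [count]
  | insert a t ha ih =>
    rw [Finset.sum_insert ha, ← ih, Finset.set_biUnion_insert, count, Set.inter_union_distrib_left,
      Set.ncard_union_eq ?_ (ω.finite_inter (hb a))
        (ω.finite_inter ((Bornology.isBounded_biUnion_finset t).2 fun i _ => hb i))]
    · rfl
    · refine Disjoint.mono Set.inter_subset_right Set.inter_subset_right ?_
      rw [Set.disjoint_iUnion₂_right]
      intro i hi
      exact hA fun h => ha (h ▸ hi)

theorem count_iUnion {κ : Type*} [Fintype κ] (ω : Sprinkling d) {A : κ → Set (Minkowski d)}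
    (hb : ∀ i, Bornology.IsBounded (A i)) (hA : Pairwise fun i j => Disjoint (A i) (A j)) :
    ω.count (⋃ i, A i) = ∑ i, ω.count (A i) := by
  simpa using ω.count_biUnion Finset.univ hb hA

end Sprinkling

/-- The set of points belonging to exactly those members of the family `B` whose index is in `s`. -/
def exactMembership {α ι : Type*} (B : ι → Set α) (s : Finset ι) : Set α :=
  {x | ∀ i, x ∈ B i ↔ i ∈ s}

theorem exactMembership_disjoint {α ι : Type*} (B : ι → Set α) {s t : Finset ι} (h : s ≠ t) :
    Disjoint (exactMembership B s) (exactMembership B t) := by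
  rw [Set.disjoint_left]
  intro x hs ht
  exact h (Finset.ext fun i => (hs i).symm.trans (ht i))

theorem measurableSet_exactMembership {α ι : Type*} [MeasurableSpace α] [Countable ι]
    {B : ι → Set α} (hB : ∀ i, MeasurableSet (B i)) (s : Finset ι) :
    MeasurableSet (exactMembership B s) := by
  have hs : exactMembership B s = ⋂ i, {x | x ∈ B i ↔ i ∈ s} := by
    ext x
    simp [exactMembership]
  rw [hs]
  refine MeasurableSet.iInter fun i => ?_
  by_cases h : i ∈ s
  · simp only [h, iff_true]
    exact hB i
  · simp only [h, iff_false]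
    exact (hB i).compl

theorem exactMembership_subset {α ι : Type*} (B : ι → Set α) {s : Finset ι} {i : ι} (hi : i ∈ s) :
    exactMembership B s ⊆ B i := fun _ hx => (hx i).2 hi

theorem iUnion_exactMembership {α ι : Type*} [Fintype ι] (B : ι → Set α) (i : ι) :
    ⋃ s : {s : Finset ι // i ∈ s}, exactMembership B s = B i := by
  classical
  refine Set.Subset.antisymm (Set.iUnion_subset fun s => exactMembership_subset B s.2) ?_
  intro x hx
  exact Set.mem_iUnion.2 ⟨⟨Finset.univ.filter fun j => x ∈ B j, by simpa using hx⟩,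
    fun j => by simp⟩

/-! ### Uniqueness of the Poisson law -/

namespace IsPoissonProcess

variable {d : ℕ} {ρ : ℝ} {μ ν : Measure (Sprinkling d)}

theorem map_count_eq (hμ : IsPoissonProcess ρ μ) (hν : IsPoissonProcess ρ ν)
    {B : Set (Minkowski d)} (hB : MeasurableSet B) (hb : Bornology.IsBounded B) :
    μ.map (Sprinkling.count B) = ν.map (Sprinkling.count B) := by
  refine Measure.ext_of_singleton fun k => ?_
  have hm := Sprinkling.measurable_count hB hb
  rw [Measure.map_apply hm (measurableSet_singleton k),
    Measure.map_apply hm (measurableSet_singleton k)]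
  exact (hμ.poisson B hB hb k).trans (hν.poisson B hB hb k).symm

theorem iIndepFun_count (hμ : IsPoissonProcess ρ μ) {κ : Type*} [Fintype κ]
    {A : κ → Set (Minkowski d)} (hA : ∀ i, MeasurableSet (A i))
    (hb : ∀ i, Bornology.IsBounded (A i)) (hd : Pairwise fun i j => Disjoint (A i) (A j)) :
    iIndepFun (fun i => Sprinkling.count (A i)) μ := by
  let e := Fintype.equivFin κ
  have h := hμ.independent _ (fun i => A (e.symm i)) (fun i => hA _) (fun i => hb _)
    fun i j hij => hd (e.symm.injective.ne hij)
  simpa [Function.comp_def] using h.precomp e.injective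

theorem map_count_pi_eq_of_disjoint (hμ : IsPoissonProcess ρ μ) (hν : IsPoissonProcess ρ ν)
    {κ : Type*} [Fintype κ]
    {A : κ → Set (Minkowski d)} (hA : ∀ i, MeasurableSet (A i))
    (hb : ∀ i, Bornology.IsBounded (A i)) (hd : Pairwise fun i j => Disjoint (A i) (A j)) :
    μ.map (fun ω i => ω.count (A i)) = ν.map fun ω i => ω.count (A i) := by
  have := hμ.isProbabilityMeasure
  have := hν.isProbabilityMeasure
  have hm := fun i => Sprinkling.measurable_count (hA i) (hb i)
  rw [(iIndepFun_iff_map_fun_eq_pi_map fun i => (hm i).aemeasurable).1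
      (hμ.iIndepFun_count hA hb hd),
    (iIndepFun_iff_map_fun_eq_pi_map fun i => (hm i).aemeasurable).1
      (hν.iIndepFun_count hA hb hd)]
  congr 1
  funext i
  exact hμ.map_count_eq hν (hA i) (hb i)

/-- Independence is given only for disjoint regions, so overlapping ones are cut into the finitely
many atoms of the algebra they generate. Each count is a sum of atom counts, hence the joint law is
the image under `F` of the joint law on the atoms. -/
theorem map_count_pi_eq (hμ : IsPoissonProcess ρ μ) (hν : IsPoissonProcess ρ ν)
    {ι : Type*} [Fintype ι] {B : ι → Set (Minkowski d)} (hB : ∀ i, MeasurableSet (B i))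
    (hb : ∀ i, Bornology.IsBounded (B i)) :
    μ.map (fun ω i => ω.count (B i)) = ν.map fun ω i => ω.count (B i) := by
  classical
  -- The atom of the empty index set is the complement of the union of all `B i`; it is unbounded
  -- and meets no `B i`, so it is left out.
  let A : {s : Finset ι // s.Nonempty} → Set (Minkowski d) := fun s => exactMembership B s
  have hA : ∀ s, MeasurableSet (A s) := fun s => measurableSet_exactMembership hB s
  have hAb : ∀ s, Bornology.IsBounded (A s) := fun s =>
    let ⟨i, hi⟩ := s.2
    (hb i).subset (exactMembership_subset B hi)
  have hAd : Pairwise fun s t => Disjoint (A s) (A t) := fun s t h =>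
    exactMembership_disjoint B (Subtype.coe_injective.ne h)
  let F : ({s : Finset ι // s.Nonempty} → ℕ) → ι → ℕ :=
    fun c i => ∑ s : {s : Finset ι // i ∈ s}, c ⟨s, i, s.2⟩
  have hF : (fun (ω : Sprinkling d) i => ω.count (B i)) = F ∘ fun ω s => ω.count (A s) := by
    funext ω i
    conv_lhs => rw [← iUnion_exactMembership B i]
    exact ω.count_iUnion (fun s => hAb ⟨s, i, s.2⟩)
      fun s t h => exactMembership_disjoint B (Subtype.coe_injective.ne h)
  have hc : Measurable fun (ω : Sprinkling d) s => ω.count (A s) :=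
    measurable_pi_lambda _ fun s => Sprinkling.measurable_count (hA s) (hAb s)
  rw [hF, ← Measure.map_map (measurable_of_countable F) hc,
    ← Measure.map_map (measurable_of_countable F) hc, hμ.map_count_pi_eq_of_disjoint hν hA hAb hAd]

/-- A Poisson process is determined by its density. -/
theorem eq (hμ : IsPoissonProcess ρ μ) (hν : IsPoissonProcess ρ ν) : μ = ν := by
  have := hμ.isProbabilityMeasure
  have := hν.isProbabilityMeasure
  -- Finite intersections of events, each depending on the count in one region, form a π-system
  -- generating Σ; each has a probability fixed by finitely many counts.
  let π : {B : Set (Minkowski d) // MeasurableSet B ∧ Bornology.IsBounded B} →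
      Set (Set (Sprinkling d)) := fun B => Set.range fun T : Set ℕ => Sprinkling.count B.1 ⁻¹' T
  have hpi : IsPiSystem (piiUnionInter π Set.univ) := by
    refine isPiSystem_piiUnionInter π (fun B => ?_) _
    rintro _ ⟨T, rfl⟩ _ ⟨T', rfl⟩ _
    exact ⟨T ∩ T', rfl⟩
  have hgen : Sprinkling.instMeasurableSpace d =
      MeasurableSpace.generateFrom (piiUnionInter π Set.univ) := by
    refine le_antisymm (MeasurableSpace.generateFrom_le ?_) ?_
    · rintro _ ⟨B, hB, hb, k, rfl⟩
      exact MeasurableSpace.measurableSet_generateFrom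
        (subset_piiUnionInter (Set.mem_univ (⟨B, hB, hb⟩ : {B : Set (Minkowski d) //
          MeasurableSet B ∧ Bornology.IsBounded B})) ⟨{k}, rfl⟩)
    · refine generateFrom_piiUnionInter_le π (fun B => MeasurableSpace.generateFrom_le ?_) _
      rintro _ ⟨T, rfl⟩
      exact Sprinkling.measurable_count B.2.1 B.2.2 T.to_countable.measurableSet
  refine ext_of_generate_finite _ hgen hpi ?_ (by simp)
  rintro _ ⟨t, -, f, hf, rfl⟩
  choose! T hT using hf
  have hset : ⋂ B ∈ t, f B = (fun (ω : Sprinkling d) (B : t) => ω.count B.1.1) ⁻¹'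
      {c | ∀ B : t, c B ∈ T B} := by
    ext ω
    simp only [Set.mem_iInter, Set.mem_preimage, Set.mem_ofPred_eq, Subtype.forall (p := (· ∈ t))]
    refine forall₂_congr fun B hB => ?_
    rw [← hT B hB]
    rfl
  have hm : Measurable fun (ω : Sprinkling d) (B : t) => ω.count B.1.1 :=
    measurable_pi_lambda _ fun B => Sprinkling.measurable_count B.1.2.1 B.1.2.2
  rw [hset, ← Measure.map_apply hm (Set.to_countable _).measurableSet,
    ← Measure.map_apply hm (Set.to_countable _).measurableSet,
    hμ.map_count_pi_eq hν (fun B => B.1.2.1) fun B => B.1.2.2]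

end IsPoissonProcess

/-! ### Lorentz invariance of the Poisson law -/

section Invariance

variable {d : ℕ}

theorem lorentzGroup_le_fullLorentzGroup : lorentzGroup d ≤ fullLorentzGroup d := by
  rintro _ ⟨A, -, rfl⟩
  exact A.2

theorem lorentzAct_mul (L M : lorentzGroup d) (x : Minkowski d) :
    lorentzAct (L * M) x = lorentzAct L (lorentzAct M x) := by
  simp [lorentzAct, Matrix.mulVec_mulVec]

theorem lorentzAct_one (x : Minkowski d) : lorentzAct 1 x = x := by
  simp [lorentzAct]

theorem lorentzAct_inv_lorentzAct (L : lorentzGroup d) (x : Minkowski d) :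
    lorentzAct L⁻¹ (lorentzAct L x) = x := by
  rw [← lorentzAct_mul, inv_mul_cancel, lorentzAct_one]

theorem lorentzAct_injective (L : lorentzGroup d) : Function.Injective (lorentzAct L) :=
  Function.LeftInverse.injective (lorentzAct_inv_lorentzAct L)

theorem continuous_lorentzAct (L : lorentzGroup d) : Continuous (lorentzAct L) := by
  unfold lorentzAct
  fun_prop

theorem isBounded_preimage_lorentzAct (L : lorentzGroup d) {B : Set (Minkowski d)}
    (hb : Bornology.IsBounded B) : Bornology.IsBounded (lorentzAct L ⁻¹' B) := by
  refine (hb.isCompact_closure.image (continuous_lorentzAct L⁻¹)).isBounded.subset ?_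
  intro x hx
  exact ⟨lorentzAct L x, subset_closure hx, lorentzAct_inv_lorentzAct L x⟩

theorem transpose_mul_minkowskiMatrix_mul {A : GL (Fin (d + 1)) ℝ} (hA : A ∈ fullLorentzGroup d) :
    (A : Matrix (Fin (d + 1)) (Fin (d + 1)) ℝ)ᵀ * minkowskiMatrix d *
      (A : Matrix (Fin (d + 1)) (Fin (d + 1)) ℝ) = minkowskiMatrix d := by
  refine Matrix.ext_of_mulVec_single fun j => ?_
  refine dotProduct_eq _ _ fun x => ?_
  have h := hA x (Pi.single j 1)
  unfold minkowskiInner at h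
  rw [dotProduct_comm, dotProduct_comm _ x, ← h, ← Matrix.mulVec_mulVec, ← Matrix.mulVec_mulVec,
    Matrix.dotProduct_mulVec, Matrix.vecMul_transpose]

/-- Take determinants in AᵀηA = η and cancel det η ≠ 0. This is what makes Lorentz maps preserve
Lebesgue measure. -/
theorem abs_det_of_mem_fullLorentzGroup {A : GL (Fin (d + 1)) ℝ} (hA : A ∈ fullLorentzGroup d) :
    |(A : Matrix (Fin (d + 1)) (Fin (d + 1)) ℝ).det| = 1 := by
  have h := congrArg Matrix.det (transpose_mul_minkowskiMatrix_mul hA)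
  rw [Matrix.det_mul, Matrix.det_mul, Matrix.det_transpose] at h
  have h0 : (minkowskiMatrix d).det ≠ 0 := by
    rw [minkowskiMatrix, Matrix.det_diagonal, Finset.prod_ne_zero_iff]
    intro i _
    split_ifs <;> norm_num
  have h1 : (A : Matrix (Fin (d + 1)) (Fin (d + 1)) ℝ).det ^ 2 = 1 :=
    mul_left_cancel₀ h0 (by linear_combination h)
  rwa [← abs_one, ← sq_eq_sq_iff_abs_eq_abs, one_pow]

theorem measurePreserving_lorentzAct (L : lorentzGroup d) :
    MeasurePreserving (lorentzAct L) volume volume := by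
  refine ⟨(continuous_lorentzAct L).measurable, ?_⟩
  have h := abs_det_of_mem_fullLorentzGroup (lorentzGroup_le_fullLorentzGroup L.2)
  have h0 : ((L : GL (Fin (d + 1)) ℝ) : Matrix (Fin (d + 1)) (Fin (d + 1)) ℝ).det ≠ 0 := by
    intro h'
    simp [h'] at h
  have := Real.map_matrix_volume_pi_eq_smul_volume_pi h0
  rw [abs_inv, h] at this
  rw [inv_one, ENNReal.ofReal_one, one_smul] at this
  exact this

namespace Sprinkling

theorem count_act (L : lorentzGroup d) (B : Set (Minkowski d)) (ω : Sprinkling d) :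
    (act L ω).count B = ω.count (lorentzAct L ⁻¹' B) := by
  rw [count, count, act, ← Set.image_inter_preimage,
    Set.ncard_image_of_injective _ (lorentzAct_injective L)]

theorem act_mul (L M : lorentzGroup d) (ω : Sprinkling d) :
    act (L * M) ω = act L (act M ω) := by
  ext1
  simp only [act, Set.image_image, lorentzAct_mul]

theorem act_one (ω : Sprinkling d) : act 1 ω = ω := by
  ext1
  simp [act, lorentzAct_one]

theorem act_iterate (L : lorentzGroup d) (n : ℕ) (ω : Sprinkling d) :
    (act L)^[n] ω = act (L ^ n) ω := by
  induction n with
  | zero => simp [act_one]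
  | succ n ih => rw [Function.iterate_succ_apply', ih, ← act_mul, pow_succ']

theorem measurable_act (L : lorentzGroup d) : Measurable (act L) := by
  refine measurable_generateFrom ?_
  rintro _ ⟨B, hB, hb, k, rfl⟩
  simp only [Set.preimage_ofPred_eq, count_act]
  exact measurable_count ((continuous_lorentzAct L).measurable hB)
    (isBounded_preimage_lorentzAct L hb) (measurableSet_singleton k)

end Sprinkling

/-- Counting a transformed sprinkling in a region is counting the original in the preimage, and
preimages keep volume, boundedness and disjointness. -/
theorem IsPoissonProcess.map_act {ρ : ℝ} {μ : Measure (Sprinkling d)}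
    (hμ : IsPoissonProcess ρ μ) (L : lorentzGroup d) :
    IsPoissonProcess ρ (μ.map (Sprinkling.act L)) := by
  have := hμ.isProbabilityMeasure
  have hL := Sprinkling.measurable_act L
  have hP : IsProbabilityMeasure (μ.map (Sprinkling.act L)) :=
    Measure.isProbabilityMeasure_map hL.aemeasurable
  have hpre : ∀ {B : Set (Minkowski d)}, MeasurableSet B → MeasurableSet (lorentzAct L ⁻¹' B) :=
    fun hB => (continuous_lorentzAct L).measurable hB
  have hcomp : ∀ B : Set (Minkowski d),
      Sprinkling.count B ∘ Sprinkling.act L = Sprinkling.count (lorentzAct L ⁻¹' B) :=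
    fun B => funext (Sprinkling.count_act L B)
  refine ⟨hP, fun B hB hb k => ?_, fun m B hB hb hd => ?_⟩
  · have hk : MeasurableSet {ω : Sprinkling d | ω.count B = k} :=
      Sprinkling.measurable_count hB hb (measurableSet_singleton k)
    rw [Measure.map_apply hL hk, Set.preimage_ofPred_eq]
    simp only [Sprinkling.count_act]
    rw [hμ.poisson _ (hpre hB) (isBounded_preimage_lorentzAct L hb),
      (measurePreserving_lorentzAct L).measure_preimage hB.nullMeasurableSet]
  · have hm := fun i => Sprinkling.measurable_count (hB i) (hb i)
    have hm' := fun i => Sprinkling.measurable_count (hpre (hB i))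
      (isBounded_preimage_lorentzAct L (hb i))
    have h := (iIndepFun_iff_map_fun_eq_pi_map fun i => (hm' i).aemeasurable).1
      (hμ.independent m (fun i => lorentzAct L ⁻¹' B i) (fun i => hpre (hB i))
        (fun i => isBounded_preimage_lorentzAct L (hb i)) fun i j hij => (hd hij).preimage _)
    rw [iIndepFun_iff_map_fun_eq_pi_map fun i => (hm i).aemeasurable,
      Measure.map_map (measurable_pi_lambda _ hm) hL]
    simp only [Measure.map_map (hm _) hL, hcomp, ← h]
    congr 1
    funext ω i
    exact Sprinkling.count_act L (B i) ω

theorem IsPoissonProcess.measurePreserving_act {ρ : ℝ} {μ : Measure (Sprinkling d)}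
    (hμ : IsPoissonProcess ρ μ) (L : lorentzGroup d) :
    MeasurePreserving (Sprinkling.act L) μ μ :=
  ⟨Sprinkling.measurable_act L, (hμ.map_act L).eq hμ⟩

end Invariance

/-! ### Boosts -/

/-- The boost of rapidity `t` in the plane of the coordinates `0` and `1`, as a linear map. -/
noncomputable def boostLinearMap (e : ℕ) (t : ℝ) : Minkowski (e + 1) →ₗ[ℝ] Minkowski (e + 1) where
  toFun x i := if i = 0 then Real.cosh t * x 0 + Real.sinh t * x 1
    else if i = 1 then Real.sinh t * x 0 + Real.cosh t * x 1 else x i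
  map_add' x y := by
    funext i
    simp only [Pi.add_apply]
    split_ifs <;> ring
  map_smul' c x := by
    funext i
    simp only [Pi.smul_apply, smul_eq_mul, RingHom.id_apply]
    split_ifs <;> ring

theorem boostLinearMap_apply (e : ℕ) (t : ℝ) (x : Minkowski (e + 1)) (i : Fin (e + 2)) :
    boostLinearMap e t x i = if i = 0 then Real.cosh t * x 0 + Real.sinh t * x 1
      else if i = 1 then Real.sinh t * x 0 + Real.cosh t * x 1 else x i := rfl

theorem boostLinearMap_comp_neg (e : ℕ) (t : ℝ) :
    boostLinearMap e t ∘ₗ boostLinearMap e (-t) = LinearMap.id := by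
  refine LinearMap.ext fun x => funext fun i => ?_
  have h := Real.cosh_sq t
  simp only [LinearMap.comp_apply, boostLinearMap_apply, LinearMap.id_apply, Real.cosh_neg,
    Real.sinh_neg, if_true, one_ne_zero, if_false]
  split_ifs with h0 h1
  · subst h0
    linear_combination x 0 * h
  · subst h1
    linear_combination x 1 * h
  · rfl

theorem minkowskiInner_eq (e : ℕ) (x y : Minkowski (e + 1)) :
    minkowskiInner x y = -(x 0 * y 0) + x 1 * y 1 +
      ∑ i : Fin e, x i.succ.succ * y i.succ.succ := by
  simp only [minkowskiInner, minkowskiMatrix, dotProduct, Matrix.mulVec_diagonal,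
    Fin.sum_univ_succ, Fin.succ_ne_zero, if_true, if_false, Fin.succ_zero_eq_one]
  simp only [one_mul]
  ring

theorem minkowskiInner_boostLinearMap (e : ℕ) (t : ℝ) (x y : Minkowski (e + 1)) :
    minkowskiInner (boostLinearMap e t x) (boostLinearMap e t y) = minkowskiInner x y := by
  have h1 : ∀ i : Fin e, i.succ.succ ≠ 1 := fun i h =>
    Fin.succ_ne_zero i (Fin.succ_injective _ h)
  simp only [minkowskiInner_eq, boostLinearMap_apply, if_true, if_false, one_ne_zero,
    Fin.succ_ne_zero, h1]
  linear_combination (x 1 * y 1 - x 0 * y 0) * Real.cosh_sq t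

/-- The boost of rapidity `t` as an invertible matrix. -/
noncomputable def boostGL (e : ℕ) (t : ℝ) : GL (Fin (e + 2)) ℝ where
  val := LinearMap.toMatrix' (boostLinearMap e t)
  inv := LinearMap.toMatrix' (boostLinearMap e (-t))
  val_inv := by
    rw [← LinearMap.toMatrix'_comp, boostLinearMap_comp_neg, LinearMap.toMatrix'_id]
  inv_val := by
    have h := boostLinearMap_comp_neg e (-t)
    rw [neg_neg] at h
    rw [← LinearMap.toMatrix'_comp, h, LinearMap.toMatrix'_id]

theorem boostGL_mulVec (e : ℕ) (t : ℝ) (x : Minkowski (e + 1)) :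
    (boostGL e t : Matrix (Fin (e + 2)) (Fin (e + 2)) ℝ) *ᵥ x = boostLinearMap e t x :=
  LinearMap.toMatrix'_mulVec _ _

theorem continuous_toMatrix_boostLinearMap (e : ℕ) :
    Continuous fun t => LinearMap.toMatrix' (boostLinearMap e t) := by
  refine continuous_matrix fun i j => ?_
  simp only [LinearMap.toMatrix'_apply, boostLinearMap_apply]
  split_ifs <;> fun_prop

theorem continuous_boostGL (e : ℕ) : Continuous (boostGL e) := by
  rw [Units.continuous_iff]
  exact ⟨continuous_toMatrix_boostLinearMap e,
    (continuous_toMatrix_boostLinearMap e).comp continuous_neg⟩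

theorem boostGL_zero (e : ℕ) : boostGL e 0 = 1 := by
  refine Units.ext ?_
  have : boostLinearMap e 0 = LinearMap.id := by
    refine LinearMap.ext fun x => funext fun i => ?_
    rw [boostLinearMap_apply]
    split_ifs with h0 h1 <;> simp [*]
  change LinearMap.toMatrix' (boostLinearMap e 0) = 1
  rw [this, LinearMap.toMatrix'_id]

theorem boostGL_mem_fullLorentzGroup (e : ℕ) (t : ℝ) :
    boostGL e t ∈ fullLorentzGroup (e + 1) := by
  intro x y
  erw [boostGL_mulVec, boostGL_mulVec]
  exact minkowskiInner_boostLinearMap e t x y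

/-- The boosts form a continuous curve through the identity, hence lie in its component. -/
theorem boostGL_mem_lorentzGroup (e : ℕ) (t : ℝ) : boostGL e t ∈ lorentzGroup (e + 1) := by
  let γ : ℝ → fullLorentzGroup (e + 1) := fun s => ⟨boostGL e s, boostGL_mem_fullLorentzGroup e s⟩
  have hγ : Continuous γ := (continuous_boostGL e).subtype_mk _
  have h0 : γ 0 = 1 := Subtype.ext (boostGL_zero e)
  refine ⟨γ t, ?_, rfl⟩
  exact (isPreconnected_range hγ).subset_connectedComponent ⟨0, h0⟩ ⟨t, rfl⟩

/-- The boost of rapidity `t` as an element of the Lorentz group. -/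
noncomputable def boost (e : ℕ) (t : ℝ) : lorentzGroup (e + 1) :=
  ⟨boostGL e t, boostGL_mem_lorentzGroup e t⟩

/-- A boost rescales the light-cone coordinate `x₀ + x₁`. -/
theorem lightCone_boost (e : ℕ) (t : ℝ) (x : Minkowski (e + 1)) :
    lorentzAct (boost e t) x 0 + lorentzAct (boost e t) x 1 = Real.exp t * (x 0 + x 1) := by
  have h : lorentzAct (boost e t) x = boostLinearMap e t x := boostGL_mulVec e t x
  rw [h, ← Real.cosh_add_sinh]
  simp only [boostLinearMap_apply, if_true, one_ne_zero, if_false]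
  ring

theorem lightCone_boost_pow (e : ℕ) (t : ℝ) (n : ℕ) (x : Minkowski (e + 1)) :
    lorentzAct (boost e t ^ n) x 0 + lorentzAct (boost e t ^ n) x 1 =
      Real.exp t ^ n * (x 0 + x 1) := by
  induction n with
  | zero => simp [lorentzAct_one]
  | succ n ih => rw [pow_succ', lorentzAct_mul, lightCone_boost, ih]; ring

/-- A future timelike vector has x₁² < x₀² and x₀ > 0, so |x₁| < x₀. -/
theorem lightCone_pos (e : ℕ) (x : Hyperboloid (e + 1)) : 0 < x.1 0 + x.1 1 := by
  obtain ⟨x, hx, h0⟩ := x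
  rw [minkowskiInner_eq] at hx
  have hs : 0 ≤ ∑ i : Fin e, x i.succ.succ * x i.succ.succ :=
    Finset.sum_nonneg fun i _ => mul_self_nonneg _
  have := abs_lt_of_sq_lt_sq (a := x 1) (b := x 0) (by nlinarith) h0.le
  linarith [(abs_lt.1 this).1]

/-! ### Recurrence against boosts -/

theorem mainTheorem2 (d : ℕ) (hd : 1 < d + 1) (ρ : ℝ) (hρ : 0 < ρ)
    (μ : MeasureTheory.Measure (Sprinkling d)) (hμ : IsPoissonProcess ρ μ)
    (S : Set (Sprinkling d)) (hS : MeasurableSet S) (hpos : 0 < μ S) :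
    ¬ ∃ D : S → Hyperboloid d, Measurable D ∧
      ∀ (L : lorentzGroup d) (ω : S) (hω : Sprinkling.act L ω ∈ S),
        (D ⟨Sprinkling.act L ω, hω⟩ : Minkowski d) = lorentzAct L (D ω) := by
  rintro ⟨D, hD, hDL⟩
  obtain ⟨e, rfl⟩ : ∃ e, d = e + 1 := ⟨d - 1, by omega⟩
  have := hμ.isProbabilityMeasure
  let u : S → ℝ := fun ω => (D ω).1 0 + (D ω).1 1
  have hu : Measurable u :=
    ((measurable_pi_apply 0).comp (measurable_subtype_coe.comp hD)).add
      ((measurable_pi_apply 1).comp (measurable_subtype_coe.comp hD))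
  have hu0 : ∀ ω, 0 < u ω := fun ω => lightCone_pos e (D ω)
  let E : ℕ → Set (Sprinkling (e + 1)) := fun N =>
    Subtype.val '' (u ⁻¹' Set.Icc ((N : ℝ) + 1)⁻¹ ((N : ℝ) + 1))
  have hE : ∀ N, MeasurableSet (E N) := fun N => hS.subtype_image (hu measurableSet_Icc)
  have hcover : S ⊆ ⋃ N, E N := by
    intro ω hω
    obtain ⟨N, hN⟩ := exists_nat_ge (max (u ⟨ω, hω⟩) (u ⟨ω, hω⟩)⁻¹)
    refine Set.mem_iUnion.2 ⟨N, ⟨ω, hω⟩, ⟨?_, ?_⟩, rfl⟩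
    · exact inv_le_of_inv_le₀ (hu0 _) (by linarith [le_max_right (u ⟨ω, hω⟩) (u ⟨ω, hω⟩)⁻¹])
    · linarith [le_max_left (u ⟨ω, hω⟩) (u ⟨ω, hω⟩)⁻¹]
  obtain ⟨N, hN⟩ := exists_measure_pos_of_not_measure_iUnion_null
    (hpos.trans_le (measure_mono hcover)).ne'
  -- A point of `E N` that stays in `E N` can have `u` multiplied by at most (N + 1)², so more than
  -- `M` boosts are too many.
  obtain ⟨M, hM⟩ := pow_unbounded_of_one_lt (((N : ℝ) + 1) ^ 2)
    (Real.one_lt_exp_iff.2 one_pos)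
  -- Poincaré recurrence for the finite invariant measure μ.
  obtain ⟨n, hn, hne⟩ := (hμ.measurePreserving_act (boost e 1)).conservative
    |>.exists_gt_measure_inter_ne_zero (hE N).nullMeasurableSet hN.ne' M
  obtain ⟨_, ⟨ω, hω, rfl⟩, hω'⟩ := nonempty_of_measure_ne_zero hne
  rw [Set.mem_preimage, Sprinkling.act_iterate] at hω'
  obtain ⟨ω', hω', heq⟩ := hω'
  -- The return is to a subset of S, so equivariance applies even if the intermediate iterates leave
  -- S.
  have hmem : Sprinkling.act (boost e 1 ^ n) ω ∈ S := heq ▸ ω'.2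
  obtain rfl : ω' = ⟨_, hmem⟩ := Subtype.ext heq
  have hscale : u ⟨_, hmem⟩ = Real.exp 1 ^ n * u ω := by
    simp only [u, hDL _ ω hmem]
    exact lightCone_boost_pow e 1 n _
  have hN0 : (0 : ℝ) < (N : ℝ) + 1 := by positivity
  have hle : Real.exp 1 ^ n * ((N : ℝ) + 1)⁻¹ ≤ (N : ℝ) + 1 :=
    (mul_le_mul_of_nonneg_left hω.1 (by positivity)).trans (hscale ▸ hω'.2)
  rw [← div_eq_mul_inv, div_le_iff₀ hN0] at hle
  have hmono : Real.exp 1 ^ M ≤ Real.exp 1 ^ n :=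
    pow_le_pow_right₀ (Real.one_le_exp zero_le_one) hn.le
  nlinarith
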